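/- For an alphabet $\Sigma$ let $\overline\Sigma=\{\bar a : a\in\Sigma\}$ be a disjoint marked copy of $\Sigma$, and for a word $w=a_1\cdots a_n\in\Sigma^*$ let $\overline w=\bar a_1\cdots\bar a_n$. The shuffle $u ⧢ v$ of two words $u,v$ is the set of all words $u_1v_1u_2v_2\cdots u_kv_k$ with $u=u_1u_2\cdots u_k$ and $v=v_1v_2\cdots v_k$, where the words $u_i,v_i$ may be empty. Theorem 3.10. It is undecidable for regular languages $R$ whether $R$ contains an element of $w ⧢ \overline w$ for some word $w$. More precisely, for every fixed finite alphabet $\Sigma$ with at least two letters, there is no algorithm that, given a finite automaton accepting a regular language $R\subseteq(\Sigma\cup\overline\Sigma)^*$, decides whether there is a word $w\in\Sigma^*$ with $R\cap(w ⧢ \overline w)\neq\emptyset$. -/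

import Mathlib

/-- The shuffle `u ⧢ v`: all words `u₁v₁u₂v₂⋯u_kv_k` with `u = u₁u₂⋯u_k` and `v = v₁v₂⋯v_k`, where
the factors `uᵢ`, `vᵢ` may be empty. The list `l` is the list of the pairs `(uᵢ, vᵢ)`. -/
def shuffle {α : Type*} (u v : List α) : Language α :=
  {x | ∃ l : List (List α × List α),
    u = (l.map fun p => p.1).flatten ∧
    v = (l.map fun p => p.2).flatten ∧
    x = (l.map fun p => p.1 ++ p.2).flatten}

/-- The disjoint union of an alphabet `α` and its marked copy: the letter `a` is `Sum.inl a`, the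
marked letter `ā` is `Sum.inr a`. -/
abbrev MarkedAlphabet (α : Type*) := α ⊕ α

/-- A word over `α`, regarded as a word over the alphabet extended by the marked letters. -/
def unmarked {α : Type*} (w : List α) : List (MarkedAlphabet α) := w.map Sum.inl

/-- The marked copy `w̄` of a word `w`. -/
def markedCopy {α : Type*} (w : List α) : List (MarkedAlphabet α) := w.map Sum.inr

/-- A finite description of a nondeterministic finite automaton over the alphabet `α`: the number of
states `m`, the list of transitions `(source, letter, target)`, the list of initial states and the
list of final states. The states are `0, …, m - 1`; entries that mention other numbers are ignored.
As a type of lists and pairs it has Mathlib's standard encoding whenever `α` has one. -/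
abbrev NFACode (α : Type*) := ℕ × List (ℕ × α × ℕ) × List ℕ × List ℕ

namespace NFACode

variable {α : Type*}

/-- The number of states. -/
def numStates (A : NFACode α) : ℕ := A.1

/-- The list of transitions. -/
def transitions (A : NFACode α) : List (ℕ × α × ℕ) := A.2.1

/-- The list of initial states. -/
def initial (A : NFACode α) : List ℕ := A.2.2.1

/-- The list of final states. -/
def final (A : NFACode α) : List ℕ := A.2.2.2

/-- The automaton that a description describes. -/
def toNFA (A : NFACode α) : NFA α (Fin (numStates A)) where
  step s a := {t | ((s : ℕ), a, (t : ℕ)) ∈ transitions A}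
  start := {s | (s : ℕ) ∈ initial A}
  accept := {s | (s : ℕ) ∈ final A}

/-- The language that a description describes. -/
def language (A : NFACode α) : Language α := (toNFA A).accepts

end NFACode

/-- Over a finite alphabet the described languages are exactly the regular ones. -/
theorem isRegular_iff_exists_NFACode {α : Type*} [Finite α] (L : Language α) :
    L.IsRegular ↔ ∃ A : NFACode α, NFACode.language A = L := by
  classical
  constructor
  · rintro ⟨σ, hσ, M, rfl⟩
    have := Fintype.ofFinite α
    rw [← DFA.accepts_reindex M (Fintype.equivFin σ)]
    generalize DFA.reindex (Fintype.equivFin σ) M = N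
    generalize Fintype.card σ = m at N
    refine ⟨(m, (Finset.univ : Finset (Fin m × α)).toList.map
        (fun p => ((p.1 : ℕ), p.2, (N.step p.1 p.2 : ℕ))), [(N.start : ℕ)],
        ((Finset.univ : Finset (Fin m)).filter (fun s => s ∈ N.accept)).toList.map
          (fun s => (s : ℕ))), ?_⟩
    rw [← DFA.toNFA_correct]
    refine congrArg (NFA.accepts (α := α) (σ := Fin m)) ?_
    have h1 : (fun (s : Fin m) (a : α) => {t : Fin m | ((s : ℕ), a, (t : ℕ)) ∈
        (Finset.univ : Finset (Fin m × α)).toList.map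
          (fun p => ((p.1 : ℕ), p.2, (N.step p.1 p.2 : ℕ)))}) = N.toNFA.step := by
      funext s a
      ext t
      simp [DFA.toNFA, Fin.val_inj, Prod.ext_iff, eq_comm]
    have h2 : {s : Fin m | (s : ℕ) ∈ [(N.start : ℕ)]} = N.toNFA.start := by
      ext s
      simp [DFA.toNFA, Fin.val_inj]
    have h3 : {s : Fin m | (s : ℕ) ∈ ((Finset.univ : Finset (Fin m)).filter
        (fun s => s ∈ N.accept)).toList.map (fun s => (s : ℕ))} = N.toNFA.accept := by
      ext s
      simp [DFA.toNFA, Fin.val_inj]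
    exact (NFA.mk.injEq ..).mpr ⟨h1, h2, h3⟩
  · rintro ⟨A, rfl⟩
    rw [Language.isRegular_iff]
    exact ⟨_, inferInstance, (NFACode.toNFA A).toDFA, NFA.toDFA_correct⟩

/-! The halting problem is reduced to the question. A word lies in the shuffle of `v` and its marked
copy exactly when its unmarked letters spell `v` and its marked letters spell `v` too
(`mem_shuffle_unmarked_markedCopy_iff`). So a regular language that writes what a queue system adds
in unmarked letters, and what it removes in marked ones, can express the equation w r₁⋯r_k = l₁⋯l_k,
which every run with rules (lᵢ, rᵢ) that empties the queue w satisfies.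

The queue system simulates a finite universal Turing machine (`exists_universal_TM0`). The queue
holds a configuration up to rotation, and after halting a signal letter erases it. Conversely, a
solution of the equation forces halting: a queue that represents a configuration has at least three
letters and no rule removes more than three, so each lᵢ is a genuine prefix of the current queue.
Each rule then preserves the configuration, performs one machine step, or shows that the machine has
halted (`Represents.of_rule`). This gives `TM0Queue.eval_dom_iff`.

Only w depends on the input. `exists_NFACode_of_rules` encodes the queue letters over the given
alphabet and fixes one automaton for the starred part; prefixing the code of w is primitive
recursive (`NFACode.primrec_prependWord`). -/

/-! ### Shuffles and projections. -/

/-- The projection of a word over the marked alphabet to its unmarked letters. -/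
abbrev unmarkedPart {α : Type*} (x : List (MarkedAlphabet α)) : List α :=
  x.filterMap Sum.getLeft?

/-- The projection of a word over the marked alphabet to its marked letters, without the marks. -/
abbrev markedPart {α : Type*} (x : List (MarkedAlphabet α)) : List α :=
  x.filterMap Sum.getRight?

@[simp] theorem unmarkedPart_unmarked {α : Type*} (w : List α) :
    unmarkedPart (unmarked w) = w := by
  induction w with
  | nil => rfl
  | cons a w ih => simpa [unmarkedPart, unmarked] using ih

@[simp] theorem unmarkedPart_markedCopy {α : Type*} (w : List α) :
    unmarkedPart (markedCopy w) = [] := by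
  simp [unmarkedPart, markedCopy]

@[simp] theorem markedPart_unmarked {α : Type*} (w : List α) :
    markedPart (unmarked w) = [] := by
  simp [markedPart, unmarked]

@[simp] theorem markedPart_markedCopy {α : Type*} (w : List α) :
    markedPart (markedCopy w) = w := by
  induction w with
  | nil => rfl
  | cons a w ih => simpa [markedPart, markedCopy] using ih

/-- A word is a shuffle of `w` and its marked copy iff both of its projections are `w`. -/
theorem mem_shuffle_unmarked_markedCopy_iff {α : Type*} (w : List α)
    (x : List (MarkedAlphabet α)) :
    x ∈ shuffle (unmarked w) (markedCopy w) ↔ unmarkedPart x = w ∧ markedPart x = w := by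
  constructor
  · rintro ⟨l, hu, hv, rfl⟩
    have h1 : ∀ p ∈ l, unmarkedPart p.2 = [] := by
      intro p hp
      have : ∀ a ∈ p.2, a ∈ markedCopy w := fun a ha => by
        rw [hv]; exact List.mem_flatten.2 ⟨_, List.mem_map_of_mem hp, ha⟩
      refine List.filterMap_eq_nil_iff.2 fun a ha => ?_
      obtain ⟨b, -, rfl⟩ := List.mem_map.1 (this a ha)
      rfl
    have h2 : ∀ p ∈ l, markedPart p.1 = [] := by
      intro p hp
      have : ∀ a ∈ p.1, a ∈ unmarked w := fun a ha => by
        rw [hu]; exact List.mem_flatten.2 ⟨_, List.mem_map_of_mem hp, ha⟩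
      refine List.filterMap_eq_nil_iff.2 fun a ha => ?_
      obtain ⟨b, -, rfl⟩ := List.mem_map.1 (this a ha)
      rfl
    have h3 : unmarkedPart (l.map fun p => p.1 ++ p.2).flatten =
        unmarkedPart (l.map fun p => p.1).flatten := by
      clear hu hv h2
      induction l with
      | nil => rfl
      | cons p l ih =>
        have := ih fun p hp => h1 p (List.mem_cons_of_mem _ hp)
        have := h1 p List.mem_cons_self
        simp_all [unmarkedPart]
    have h4 : markedPart (l.map fun p => p.1 ++ p.2).flatten =
        markedPart (l.map fun p => p.2).flatten := by
      clear hu hv h1 h3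
      induction l with
      | nil => rfl
      | cons p l ih =>
        have := ih fun p hp => h2 p (List.mem_cons_of_mem _ hp)
        have := h2 p List.mem_cons_self
        simp_all [markedPart]
    rw [h3, h4, ← hu, ← hv]
    simp
  · rintro ⟨h1, h2⟩
    -- Cut `x` into single letters; each gives a pair with one empty component.
    refine ⟨x.map fun a => Sum.elim (fun b => ([Sum.inl b], [])) (fun b => ([], [Sum.inr b])) a,
      ?_, ?_, ?_⟩
    · rw [← h1]; clear h1 h2
      induction x with
      | nil => rfl
      | cons a x ih => cases a <;> simp_all [unmarked, unmarkedPart, List.filterMap_cons]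
    · rw [← h2]; clear h1 h2
      induction x with
      | nil => rfl
      | cons a x ih => cases a <;> simp_all [markedCopy, markedPart, List.filterMap_cons]
    · clear h1 h2
      induction x with
      | nil => rfl
      | cons a x ih => cases a <;> exact congrArg (List.cons _) ih

/-! ### Regularity of the star of a finite language. -/

/-- The flower automaton of a set of words: a state is the rest of the word being read. -/
def flowerNFA {α : Type*} (X : Set (List α)) :
    NFA α {s : List α // s = [] ∨ ∃ x ∈ X, s <:+ x} where
  step s a := {t | s.1 = a :: t.1 ∨ s.1 = [] ∧ a :: t.1 ∈ X}
  start := {⟨[], Or.inl rfl⟩}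
  accept := {⟨[], Or.inl rfl⟩}

/-- From state `s` the automaton must first finish `s`. An arbitrary `s` is needed because reading a
letter leaves the initial state. -/
theorem mem_flowerNFA_acceptsFrom {α : Type*} (X : Set (List α)) (y : List α) :
    ∀ s, y ∈ (flowerNFA X).acceptsFrom {s} ↔
      ∃ L : List (List α), (∀ x ∈ L, x ∈ X) ∧ y = s.1 ++ L.flatten := by
  induction y with
  | nil =>
    intro s
    rw [NFA.nil_mem_acceptsFrom]
    constructor
    · rintro ⟨t, rfl, ht⟩
      exact ⟨[], by simp, by simp [show t = ⟨[], _⟩ from ht]⟩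
    · rintro ⟨L, -, h⟩
      exact ⟨s, rfl, Subtype.ext (List.append_eq_nil_iff.1 h.symm).1⟩
  | cons a y ih =>
    intro s
    rw [NFA.cons_mem_acceptsFrom, NFA.stepSet_singleton, NFA.mem_acceptsFrom]
    have key : (∃ t ∈ (flowerNFA X).accept, t ∈ (flowerNFA X).evalFrom ((flowerNFA X).step s a) y) ↔
        ∃ t ∈ (flowerNFA X).step s a, y ∈ (flowerNFA X).acceptsFrom {t} := by
      simp only [NFA.mem_acceptsFrom]
      constructor
      · rintro ⟨t, ht, h⟩
        obtain ⟨u, hu, h⟩ := NFA.mem_evalFrom_iff_exists.1 h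
        exact ⟨u, hu, t, ht, h⟩
      · rintro ⟨u, hu, t, ht, h⟩
        exact ⟨t, ht, NFA.mem_evalFrom_iff_exists.2 ⟨u, hu, h⟩⟩
    rw [key]
    simp only [ih]
    constructor
    · rintro ⟨t, ht | ⟨hs, ht⟩, L, hL, rfl⟩
      · exact ⟨L, hL, by simp [ht]⟩
      · exact ⟨(a :: t.1) :: L, by simpa using ⟨ht, hL⟩, by simp [hs]⟩
    · rintro ⟨L, hL, h⟩
      obtain ⟨s, hs⟩ := s
      cases s with
      | cons b s =>
        obtain ⟨rfl, rfl⟩ : a = b ∧ y = s ++ L.flatten := by simpa using h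
        refine ⟨⟨s, Or.inr ?_⟩, Or.inl rfl, L, hL, rfl⟩
        obtain h' | ⟨x, hx, h'⟩ := hs
        · cases h'
        · exact ⟨x, hx, (List.suffix_cons _ _).trans h'⟩
      | nil =>
        -- Empty words in `L` contribute no letter, so they are skipped until a nonempty one
        -- supplies `a`.
        induction L with
        | nil => simp at h
        | cons x L ihL =>
          cases x with
          | nil => exact ihL (fun x hx => hL x (List.mem_cons_of_mem _ hx)) (by simpa using h)
          | cons b x =>
            obtain ⟨rfl, rfl⟩ : a = b ∧ y = x ++ L.flatten := by simpa using h
            exact ⟨⟨x, Or.inr ⟨_, hL _ List.mem_cons_self, List.suffix_cons _ _⟩⟩,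
              Or.inr ⟨rfl, hL _ List.mem_cons_self⟩, L,
              fun x hx => hL x (List.mem_cons_of_mem _ hx), rfl⟩

theorem Language.isRegular_kstar_of_finite {α : Type*} {X : Language α}
    (hX : Set.Finite (X : Set (List α))) : (KStar.kstar X).IsRegular := by
  have : Finite {s : List α // s = [] ∨ ∃ x ∈ (X : Set (List α)), s <:+ x} := by
    refine Set.Finite.to_subtype
      (Set.Finite.subset ((Set.finite_singleton []).union (hX.biUnion fun x _ =>
        (List.finite_toSet x.tails))) ?_)
    rintro s (rfl | ⟨x, hx, h⟩)
    · exact Or.inl rfl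
    · exact Or.inr (Set.mem_biUnion hx ((List.mem_tails _ _).2 h))
  have := Fintype.ofFinite {s : List α // s = [] ∨ ∃ x ∈ (X : Set (List α)), s <:+ x}
  rw [Language.isRegular_iff]
  refine ⟨_, inferInstance, (flowerNFA (X : Set (List α))).toDFA, ?_⟩
  rw [NFA.toDFA_correct]
  ext y
  rw [NFA.accepts_eq_acceptsFrom_start]
  refine (mem_flowerNFA_acceptsFrom _ y _).trans ?_
  rw [Language.mem_kstar]
  exact ⟨fun ⟨L, h, e⟩ => ⟨L, e, h⟩, fun ⟨L, e, h⟩ => ⟨L, h, e⟩⟩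

/-! ### Prefixing a word to an automaton, computably. -/

namespace NFACode

variable {α : Type*}

/-- The description mentions no numbers other than its states. -/
def WellFormed (A : NFACode α) : Prop :=
  (∀ p ∈ A.transitions, p.1 < A.numStates ∧ p.2.2 < A.numStates) ∧
    (∀ s ∈ A.initial, s < A.numStates) ∧ ∀ s ∈ A.final, s < A.numStates

/-- Remove all entries that mention other numbers than the states. -/
def sanitize (A : NFACode α) : NFACode α :=
  (A.1, A.2.1.filter (fun p => p.1 < A.1 ∧ p.2.2 < A.1), A.2.2.1.filter (· < A.1),
    A.2.2.2.filter (· < A.1))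

theorem wellFormed_sanitize (A : NFACode α) : A.sanitize.WellFormed := by
  refine ⟨fun p hp => ?_, fun s hs => ?_, fun s hs => ?_⟩
  · exact of_decide_eq_true (List.mem_filter.1 hp).2
  · exact of_decide_eq_true (List.mem_filter.1 hs).2
  · exact of_decide_eq_true (List.mem_filter.1 hs).2

theorem language_sanitize (A : NFACode α) : A.sanitize.language = A.language := by
  refine congrArg (NFA.accepts (α := α) (σ := Fin A.1)) ((NFA.mk.injEq ..).mpr ⟨?_, ?_, ?_⟩)
  · funext s a
    ext t
    exact List.mem_filter.trans (and_iff_left (decide_eq_true ⟨s.2, t.2⟩))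
  · ext t
    exact List.mem_filter.trans (and_iff_left (decide_eq_true t.2))
  · ext t
    exact List.mem_filter.trans (and_iff_left (decide_eq_true t.2))

/-- The runs of a description, with states taken in `ℕ`. -/
inductive Run (T : List (ℕ × α × ℕ)) (F : List ℕ) : ℕ → List α → Prop
  | nil {s : ℕ} (hs : s ∈ F) : Run T F s []
  | cons {s t : ℕ} {a : α} {x : List α} (h : (s, a, t) ∈ T) (hx : Run T F t x) :
      Run T F s (a :: x)

/-- Runs with states in `ℕ` avoid transporting between the types `Fin m` and `Fin (m + 1)` when a
state is added. -/
theorem mem_language_iff_of_wellFormed {A : NFACode α} (hA : A.WellFormed) (x : List α) :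
    x ∈ A.language ↔ ∃ s ∈ A.initial, Run A.transitions A.final s x := by
  have key : ∀ (x : List α) (s : Fin A.numStates),
      x ∈ A.toNFA.acceptsFrom {s} ↔ Run A.transitions A.final s x := by
    intro x
    induction x with
    | nil =>
      intro s
      rw [NFA.nil_mem_acceptsFrom]
      exact ⟨fun ⟨t, e, h⟩ => .nil (by rw [← show t = s from e]; exact h),
        fun h => ⟨s, rfl, by cases h; assumption⟩⟩
    | cons a x ih =>
      intro s
      rw [NFA.cons_mem_acceptsFrom, NFA.stepSet_singleton]
      constructor
      · rintro ⟨t, ht, h⟩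
        obtain ⟨u, hu, h⟩ := NFA.mem_evalFrom_iff_exists.1 h
        exact .cons hu ((ih u).1 ⟨t, ht, h⟩)
      · intro h
        obtain ⟨t, hT, hx⟩ : ∃ t, ((s : ℕ), a, t) ∈ A.transitions ∧
            Run A.transitions A.final t x := by
          cases h with
          | cons hT hx => exact ⟨_, hT, hx⟩
        obtain ⟨u, hu, h⟩ := (ih ⟨t, (hA.1 _ hT).2⟩).2 hx
        exact ⟨u, hu, NFA.mem_evalFrom_iff_exists.2 ⟨_, hT, h⟩⟩
  constructor
  · rintro ⟨u, hu, h⟩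
    obtain ⟨s, hs, h⟩ := NFA.mem_evalFrom_iff_exists.1 h
    exact ⟨s, hs, (key x s).1 ⟨u, hu, h⟩⟩
  · rintro ⟨s, hs, h⟩
    obtain ⟨u, hu, h⟩ := (key x ⟨s, hA.2.1 s hs⟩).2 h
    exact ⟨u, hu, NFA.mem_evalFrom_iff_exists.2 ⟨_, hs, h⟩⟩

/-- A description of the language of the words `a :: x` with `x` in the given language. -/
def consLetter (a : α) (A : NFACode α) : NFACode α :=
  (A.1 + 1, A.2.2.1.map (fun s => (A.1, a, s)) ++ A.2.1, [A.1], A.2.2.2)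

theorem wellFormed_consLetter {A : NFACode α} (hA : A.WellFormed) (a : α) :
    (consLetter a A).WellFormed := by
  obtain ⟨h1, h2, h3⟩ := hA
  refine ⟨fun p hp => ?_, fun s hs => ?_, fun s hs => (h3 s hs).trans (Nat.lt_succ_self _)⟩
  · obtain hp | hp := List.mem_append.1 hp
    · obtain ⟨s, hs, rfl⟩ := List.mem_map.1 hp
      exact ⟨Nat.lt_succ_self _, (h2 s hs).trans (Nat.lt_succ_self _)⟩
    · exact ⟨(h1 p hp).1.trans (Nat.lt_succ_self _), (h1 p hp).2.trans (Nat.lt_succ_self _)⟩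
  · rw [List.mem_singleton.1 hs]
    exact Nat.lt_succ_self _

/-- The new initial state `A.1` lies outside the old range, so no old transition touches it, and no
run re-enters it. -/
theorem mem_language_consLetter {A : NFACode α} (hA : A.WellFormed) (a : α) (x : List α) :
    x ∈ (consLetter a A).language ↔ ∃ y ∈ A.language, x = a :: y := by
  have key : ∀ (y : List α) (s : ℕ), s < A.numStates →
      (Run (consLetter a A).transitions A.final s y ↔ Run A.transitions A.final s y) := by
    intro y s hs
    constructor
    · intro h
      induction h with
      | nil h => exact .nil h
      | cons h _ ih =>
        obtain h | h := List.mem_append.1 h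
        · obtain ⟨t, ht, e⟩ := List.mem_map.1 h
          cases e
          exact absurd hs (lt_irrefl _)
        · exact .cons h (ih (hA.1 _ h).2)
    · intro h
      clear hs
      induction h with
      | nil h => exact .nil h
      | cons h _ ih => exact .cons (List.mem_append_right _ h) ih
  rw [mem_language_iff_of_wellFormed (wellFormed_consLetter hA a)]
  simp only [mem_language_iff_of_wellFormed hA]
  constructor
  · rintro ⟨s, hs, h⟩
    obtain rfl := List.mem_singleton.1 hs
    cases h with
    | nil h => exact absurd (hA.2.2 _ h) (lt_irrefl _)
    | cons h hx =>
      obtain h | h := List.mem_append.1 h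
      · obtain ⟨t, ht, e⟩ := List.mem_map.1 h
        cases e
        exact ⟨_, ⟨_, ht, (key _ _ (hA.2.1 _ ht)).1 hx⟩, rfl⟩
      · exact absurd (hA.1 _ h).1 (lt_irrefl _)
  · rintro ⟨y, ⟨t, ht, hy⟩, rfl⟩
    exact ⟨A.1, List.mem_singleton_self _,
      .cons (List.mem_append_left _ (List.mem_map.2 ⟨t, ht, rfl⟩)) ((key _ _ (hA.2.1 t ht)).2 hy)⟩

/-- A description of the language of the words `u ++ x` with `x` in the given language. -/
def prependWord (u : List α) (A : NFACode α) : NFACode α :=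
  u.foldr consLetter A

theorem wellFormed_prependWord {A : NFACode α} (hA : A.WellFormed) (u : List α) :
    (prependWord u A).WellFormed := by
  induction u with
  | nil => exact hA
  | cons a u ih => exact wellFormed_consLetter ih a

theorem mem_language_prependWord {A : NFACode α} (hA : A.WellFormed) (u x : List α) :
    x ∈ (prependWord u A).language ↔ ∃ y ∈ A.language, x = u ++ y := by
  induction u generalizing x with
  | nil => simp [prependWord]
  | cons a u ih =>
    refine (mem_language_consLetter (wellFormed_prependWord hA u) a x).trans ?_
    constructor
    · rintro ⟨y, hy, rfl⟩
      obtain ⟨z, hz, rfl⟩ := (ih y).1 hy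
      exact ⟨z, hz, rfl⟩
    · rintro ⟨z, hz, rfl⟩
      exact ⟨u ++ z, (ih _).2 ⟨z, hz, rfl⟩, rfl⟩

theorem primrec_consLetter [Primcodable α] :
    Primrec₂ (consLetter : α → NFACode α → NFACode α) := by
  have hA : Primrec fun p : α × NFACode α => p.2 := Primrec.snd
  have h1 : Primrec fun p : α × NFACode α => p.2.1 := Primrec.fst.comp hA
  have h2 : Primrec fun p : α × NFACode α => p.2.2 := Primrec.snd.comp hA
  have hT : Primrec fun p : α × NFACode α => p.2.2.1 := Primrec.fst.comp h2
  have hI : Primrec fun p : α × NFACode α => p.2.2.2.1 :=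
    Primrec.fst.comp (Primrec.snd.comp h2)
  have hF : Primrec fun p : α × NFACode α => p.2.2.2.2 :=
    Primrec.snd.comp (Primrec.snd.comp h2)
  have hg : Primrec₂ fun (p : α × NFACode α) (s : ℕ) => (p.2.1, p.1, s) :=
    Primrec.pair (h1.comp Primrec.fst)
      (Primrec.pair (Primrec.fst.comp Primrec.fst) Primrec.snd)
  exact Primrec.pair (Primrec.succ.comp h1) (Primrec.pair
    (Primrec.list_append.comp (Primrec.list_map hI hg) hT)
    (Primrec.pair (Primrec.list_cons.comp h1 (Primrec.const [])) hF))

theorem primrec_prependWord [Primcodable α] (A : NFACode α) :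
    Primrec fun u : List α => prependWord u A :=
  Primrec.list_foldr Primrec.id (Primrec.const A)
    (primrec_consLetter.comp (Primrec.fst.comp Primrec.snd) (Primrec.snd.comp Primrec.snd)).to₂

end NFACode

/-! ### Queue systems and the equation of their runs. -/

/-- One step of the queue system with the given rules: a rule `(l, r)` removes `l` at the front of
the queue and adds `r` at its end. -/
inductive QueueStep {δ : Type*} (rule : List δ → List δ → Prop) : List δ → List δ → Prop
  | mk {l r : List δ} (h : rule l r) (w : List δ) : QueueStep rule (l ++ w) (w ++ r)

/-- If a queue can be emptied, then there is a sequence of rules such that the initial content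
followed by everything that is added is everything that is removed. -/
theorem exists_rules_of_queue_reaches_nil {δ : Type*} {rule : List δ → List δ → Prop}
    {w : List δ} (h : Relation.ReflTransGen (QueueStep rule) w []) :
    ∃ D : List (List δ × List δ), (∀ p ∈ D, rule p.1 p.2) ∧
      w ++ (D.map Prod.snd).flatten = (D.map Prod.fst).flatten := by
  induction h using Relation.ReflTransGen.head_induction_on with
  | refl => exact ⟨[], by simp, rfl⟩
  | head h _ ih =>
    obtain @⟨l, r, hlr, w⟩ := h
    obtain ⟨D, hD, e⟩ := ih
    exact ⟨(l, r) :: D, by simpa using ⟨hlr, fun a b h => hD _ h⟩, by simp [← e]⟩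

/-! ### Simulation of a Turing machine by a queue system. -/

namespace TM0Queue

open Turing Relation

/-- The letters of the queue system that simulates a Turing machine: states, tape symbols, a
separator and a letter that signals halting. -/
inductive Letter (Γ Λ : Type*)
  | state (q : Λ)
  | sym (a : Γ)
  | sep
  | fin

open Letter

variable {Γ Λ : Type*}

/-- The contents of the tape, read cyclically to the right from the head on. The left part `L` is
given in the order from the head to the left. -/
def tapeWord (L R : List Γ) : List (Letter Γ Λ) :=
  R.map sym ++ sep :: sep :: (L.map sym).reverse

/-- The letters that are neither states nor the halting signal. -/
inductive IsTapeLetter : Letter Γ Λ → Prop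
  | sym (a : Γ) : IsTapeLetter (sym a)
  | sep : IsTapeLetter sep

theorem isTapeLetter_of_mem_tapeWord {L R : List Γ} {x : Letter Γ Λ}
    (h : x ∈ tapeWord (Λ := Λ) L R) : IsTapeLetter x := by
  simp only [tapeWord, List.mem_append, List.mem_map, List.mem_cons, List.mem_reverse] at h
  obtain ⟨a, -, rfl⟩ | rfl | rfl | ⟨a, -, rfl⟩ := h
  exacts [.sym a, .sep, .sep, .sym a]

/-- A nontrivial rotation would move `a` into `v`, where every letter satisfies `P`. Hence the
unique state letter fixes where a cyclic word is cut. -/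
theorem eq_of_isRotated_cons {δ : Type*} {P : δ → Prop} {a b : δ} {u v : List δ}
    (ha : ¬ P a) (hv : ∀ x ∈ v, P x) (h : a :: u ~r b :: v) : a = b ∧ u = v := by
  obtain ⟨n, hn, e⟩ := List.isRotated_iff_mod.1 h
  rw [List.rotate_eq_drop_append_take hn] at e
  cases n with
  | zero => simpa using e
  | succ n =>
    rw [List.drop_succ_cons, List.take_succ_cons] at e
    -- An empty rest means a full turn; otherwise `a` occurs in `v`.
    cases hd : u.drop n with
    | nil =>
      rw [hd, List.nil_append] at e
      have : u.take n = u := List.take_of_length_le (by simpa using hd)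
      rw [this] at e
      simpa using e
    | cons c t =>
      rw [hd, List.cons_append, List.cons.injEq] at e
      exact absurd (hv a (by rw [← e.2]; simp)) ha

theorem tapeWord_eq_sym_cons {L R : List Γ} {a : Γ} {u : List (Letter Γ Λ)}
    (h : sym a :: u = tapeWord L R) : ∃ R', R = a :: R' ∧ u = tapeWord L R' := by
  cases R with
  | nil => cases h
  | cons b R =>
    obtain ⟨rfl, rfl⟩ : a = b ∧ u = tapeWord L R := by simpa [tapeWord] using h
    exact ⟨R, rfl, rfl⟩

theorem tapeWord_eq_sep_cons {L R : List Γ} {u : List (Letter Γ Λ)}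
    (h : Letter.sep :: u = tapeWord L R) : R = [] ∧ u = sep :: (L.map sym).reverse := by
  cases R with
  | nil => simpa [tapeWord] using h
  | cons b R => cases h

theorem tapeWord_eq_concat_sym {L R : List Γ} {a : Γ} {u : List (Letter Γ Λ)}
    (h : u ++ [sym a] = tapeWord L R) : ∃ L', L = a :: L' ∧ u = tapeWord L' R := by
  cases L with
  | nil =>
    have : u ++ [sym a] = (R.map sym ++ [sep]) ++ [sep] := by simpa [tapeWord] using h
    cases (List.append_inj' this rfl).2
  | cons b L =>
    have : u ++ [sym a] = tapeWord L R ++ [sym b] := by simpa [tapeWord] using h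
    obtain ⟨h1, h2⟩ := List.append_inj' this rfl
    obtain rfl : a = b := by simpa using h2
    exact ⟨L, rfl, h1⟩

theorem tapeWord_eq_concat_sep {L R : List Γ} {u : List (Letter Γ Λ)}
    (h : u ++ [Letter.sep] = tapeWord L R) : L = [] ∧ u = R.map sym ++ [sep] := by
  cases L with
  | nil =>
    have : u ++ [sep] = (R.map sym ++ [sep]) ++ [sep] := by simpa [tapeWord] using h
    exact ⟨rfl, (List.append_inj' this rfl).1⟩
  | cons b L =>
    have : u ++ [sep] = tapeWord L R ++ [sym b] := by simpa [tapeWord] using h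
    cases (List.append_inj' this rfl).2

variable [Inhabited Γ]

theorem tape_head_mk₂_cons (L R : List Γ) (a : Γ) : (Tape.mk₂ L (a :: R)).head = a := rfl

theorem tape_write_mk₂_cons (L R : List Γ) (a b : Γ) :
    (Tape.mk₂ L (a :: R)).write b = Tape.mk₂ L (b :: R) := rfl

theorem tape_move_right_mk₂_cons (L R : List Γ) (a : Γ) :
    (Tape.mk₂ L (a :: R)).move .right = Tape.mk₂ (a :: L) R := by
  simp [Tape.mk₂, Tape.move_right_mk']

theorem tape_move_left_mk₂_cons (L R : List Γ) (b : Γ) :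
    (Tape.mk₂ (b :: L) R).move .left = Tape.mk₂ L (b :: R) := by
  simp [Tape.mk₂, Tape.move_left_mk']

theorem tape_move_left_mk₂_nil (R : List Γ) :
    (Tape.mk₂ [] R).move .left = Tape.mk₂ [] (default :: R) := by
  simp [Tape.mk₂, Tape.move_left_mk']

/-- Half-tapes are taken up to trailing blanks; this justifies the rule `extend`. -/
theorem tape_mk₂_nil_right (L : List Γ) : Tape.mk₂ L [] = Tape.mk₂ L [default] := by
  simp only [Tape.mk₂]
  congr 1
  exact Quotient.sound' (Or.inl ⟨1, rfl⟩)

/-- The queue content `w` is a rotation of the description of the configuration `c`. -/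
def Represents (c : TM0.Cfg Γ Λ) (w : List (Letter Γ Λ)) : Prop :=
  ∃ L R : List Γ, c.Tape = Tape.mk₂ L R ∧ w ~r state c.q :: tapeWord L R

theorem Represents.eq_of_state {c : TM0.Cfg Γ Λ} {w u : List (Letter Γ Λ)} {q : Λ}
    (h : Represents c w) (hw : w ~r state q :: u) :
    q = c.q ∧ ∃ L R, c.Tape = Tape.mk₂ L R ∧ u = tapeWord L R := by
  obtain ⟨L, R, hT, hr⟩ := h
  obtain ⟨e, rfl⟩ := eq_of_isRotated_cons (P := IsTapeLetter) (by rintro ⟨⟩)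
    (fun x hx => isTapeLetter_of_mem_tapeWord hx) (hw.symm.trans hr)
  exact ⟨by simpa using e, L, R, hT, rfl⟩

theorem Represents.fin_notMem {c : TM0.Cfg Γ Λ} {w : List (Letter Γ Λ)} (h : Represents c w) :
    Letter.fin ∉ w := by
  obtain ⟨L, R, -, hr⟩ := h
  rw [hr.mem_iff, List.mem_cons]
  rintro (h | h)
  · cases h
  · cases isTapeLetter_of_mem_tapeWord h

/-- The state and the two separators always count; the bound matches `Rule.length_fst_le`. -/
theorem Represents.three_le_length {c : TM0.Cfg Γ Λ} {w : List (Letter Γ Λ)}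
    (h : Represents c w) : 3 ≤ w.length := by
  obtain ⟨L, R, -, hr⟩ := h
  rw [hr.perm.length_eq]
  simp [tapeWord]
  omega

/-- The queue content `w` is a rotation of the description of the configuration `c` in which the
state is not the first letter. -/
def Simulates (c : TM0.Cfg Γ Λ) (w : List (Letter Γ Λ)) : Prop :=
  ∃ L R u v, c.Tape = Tape.mk₂ L R ∧ v ≠ [] ∧ u ++ v = tapeWord L R ∧ w = v ++ state c.q :: u

theorem Simulates.represents {c : TM0.Cfg Γ Λ} {w : List (Letter Γ Λ)} (h : Simulates c w) :
    Represents c w := by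
  obtain ⟨L, R, u, v, hT, -, e, rfl⟩ := h
  exact ⟨L, R, hT, List.isRotated_append.trans (by simp [← e, List.IsRotated.refl])⟩

variable [Inhabited Λ]

/-- The rules of the queue system that simulates a Turing machine. -/
inductive Rule (M : TM0.Machine Γ Λ) : List (Letter Γ Λ) → List (Letter Γ Λ) → Prop
  | sym (a : Γ) : Rule M [sym a] [sym a]
  | sep : Rule M [sep] [sep]
  | extend (q : Λ) : Rule M [state q, sep] [state q, sym default, sep]
  | write {q q' : Λ} {a b : Γ} (h : M q a = some (q', .write b)) :
      Rule M [state q, sym a] [state q', sym b]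
  | right {q q' : Λ} {a : Γ} (h : M q a = some (q', .move .right)) :
      Rule M [state q, sym a] [sym a, state q']
  | left {q q' : Λ} {a : Γ} (b : Γ) (h : M q a = some (q', .move .left)) :
      Rule M [sym b, state q, sym a] [state q', sym b, sym a]
  | leftSep {q q' : Λ} {a : Γ} (h : M q a = some (q', .move .left)) :
      Rule M [sep, state q, sym a] [sep, state q', sym default, sym a]
  | halt {q : Λ} {a : Γ} (h : M q a = none) : Rule M [state q, sym a] [fin]
  | eraseSym (a : Γ) : Rule M [fin, sym a] [fin]
  | eraseSep : Rule M [fin, sep] [fin]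
  | done : Rule M [fin] []

theorem IsTapeLetter.rule {M : TM0.Machine Γ Λ} {x : Letter Γ Λ} (h : IsTapeLetter x) :
    Rule M [x] [x] := by
  cases h
  exacts [.sym _, .sep]

theorem Rule.length_fst_le {M : TM0.Machine Γ Λ} {l r : List (Letter Γ Λ)} (h : Rule M l r) :
    l.length ≤ 3 := by
  cases h <;> simp

theorem Rule.length_snd_le {M : TM0.Machine Γ Λ} {l r : List (Letter Γ Λ)} (h : Rule M l r) :
    r.length ≤ 4 := by
  cases h <;> simp

/-- A step of the queue system is no step or a step of the Turing machine, or the machine has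
halted. -/
theorem Represents.of_rule {M : TM0.Machine Γ Λ} {c : TM0.Cfg Γ Λ} {l r w : List (Letter Γ Λ)}
    (h : Rule M l r) (hc : Represents c (l ++ w)) :
    TM0.step M c = none ∨ Represents c (w ++ r) ∨
      ∃ c' ∈ TM0.step M c, Represents c' (w ++ r) := by
  have hstep : ∀ {a : Γ}, c.Tape.head = a → ∀ {q' s}, M c.q a = some (q', s) →
      TM0.step M c = some ⟨q', match s with
        | .move d => c.Tape.move d
        | .write b => c.Tape.write b⟩ := by
    rintro _ rfl q' s h
    obtain ⟨q, T⟩ := c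
    cases s <;> simp [TM0.step, h]
  cases h with
  | sym a => exact .inr <| .inl <| hc.imp fun L ⟨R, hT, hr⟩ =>
      ⟨R, hT, List.isRotated_append.trans hr⟩
  | sep => exact .inr <| .inl <| hc.imp fun L ⟨R, hT, hr⟩ =>
      ⟨R, hT, List.isRotated_append.trans hr⟩
  | extend q =>
    obtain ⟨rfl, L, R, hT, e⟩ := hc.eq_of_state (List.IsRotated.refl _)
    obtain ⟨rfl, rfl⟩ := tapeWord_eq_sep_cons e
    refine .inr <| .inl ⟨L, [default], hT.trans (tape_mk₂_nil_right L), ?_⟩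
    exact List.isRotated_append.trans (by simp [tapeWord, List.IsRotated.refl])
  | @write q q' a b h =>
    obtain ⟨rfl, L, R, hT, e⟩ := hc.eq_of_state (List.IsRotated.refl _)
    obtain ⟨R, rfl, rfl⟩ := tapeWord_eq_sym_cons e
    refine .inr <| .inr ⟨_, hstep (by rw [hT]; rfl) h, L, b :: R, ?_, ?_⟩
    · simp only [hT, tape_write_mk₂_cons]
    · exact List.isRotated_append.trans (by simp [tapeWord, List.IsRotated.refl])
  | @right q q' a h =>
    obtain ⟨rfl, L, R, hT, e⟩ := hc.eq_of_state (List.IsRotated.refl _)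
    obtain ⟨R, rfl, rfl⟩ := tapeWord_eq_sym_cons e
    refine .inr <| .inr ⟨_, hstep (by rw [hT]; rfl) h, a :: L, R, ?_, ?_⟩
    · simp only [hT, tape_move_right_mk₂_cons]
    · have := List.isRotated_append (l := tapeWord L R ++ [sym a]) (l' := [state q'])
      simpa [tapeWord] using this
  | @left q q' a b h =>
    -- Rotating `sym b` to the end puts the state first, so `b` becomes the last letter of the tape
    -- word, the cell left of the head.
    obtain ⟨rfl, L, R, hT, e⟩ := hc.eq_of_state
      (List.isRotated_append (l := [sym b]) (l' := state q :: sym a :: w))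
    obtain ⟨R, rfl, e'⟩ := tapeWord_eq_sym_cons e
    obtain ⟨L, rfl, rfl⟩ := tapeWord_eq_concat_sym e'
    refine .inr <| .inr ⟨_, hstep (by rw [hT]; rfl) h, L, b :: a :: R, ?_, ?_⟩
    · simp only [hT, tape_move_left_mk₂_cons]
    · exact List.isRotated_append.trans (by simp [tapeWord, List.IsRotated.refl])
  | @leftSep q q' a h =>
    obtain ⟨rfl, L, R, hT, e⟩ := hc.eq_of_state
      (List.isRotated_append (l := [Letter.sep]) (l' := state q :: sym a :: w))
    obtain ⟨R, rfl, e'⟩ := tapeWord_eq_sym_cons e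
    obtain ⟨rfl, rfl⟩ := tapeWord_eq_concat_sep e'
    refine .inr <| .inr ⟨_, hstep (by rw [hT]; rfl) h, [], default :: a :: R, ?_, ?_⟩
    · simp only [hT, tape_move_left_mk₂_nil]
    · have := List.isRotated_append (l := R.map sym ++ [sep, sep])
        (l' := [state q', sym default, sym a])
      simpa [tapeWord] using this
  | @halt q a h =>
    obtain ⟨rfl, L, R, hT, e⟩ := hc.eq_of_state (List.IsRotated.refl _)
    obtain ⟨R, rfl, rfl⟩ := tapeWord_eq_sym_cons e
    left
    obtain ⟨q, T⟩ := c
    obtain rfl := hT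
    simp only [TM0.step]
    rw [tape_head_mk₂_cons, h]
    rfl
  -- The signal `fin` never occurs in a represented configuration.
  | eraseSym a => exact absurd (by simp) hc.fin_notMem
  | eraseSep => exact absurd (by simp) hc.fin_notMem
  | done => exact absurd (by simp) hc.fin_notMem

/-- If the queue can be emptied, then the machine halts. -/
theorem Represents.eval_dom {M : TM0.Machine Γ Λ} (D : List (List (Letter Γ Λ) × List (Letter Γ Λ)))
    (hD : ∀ p ∈ D, Rule M p.1 p.2) :
    ∀ {c : TM0.Cfg Γ Λ} {w : List (Letter Γ Λ)}, Represents c w →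
      w ++ (D.map Prod.snd).flatten = (D.map Prod.fst).flatten →
      (StateTransition.eval (TM0.step M) c).Dom := by
  induction D with
  | nil =>
    intro c w hc e
    have := hc.three_le_length
    simp_all
  | cons p D ih =>
    intro c w hc e
    obtain ⟨l, r⟩ := p
    have hlr : Rule M l r := hD _ List.mem_cons_self
    have hD' : ∀ p ∈ D, Rule M p.1 p.2 := fun p hp => hD _ (List.mem_cons_of_mem _ hp)
    -- Both `l` and `w` are prefixes of the same word, and `l` is no longer than `w`; so the
    -- equation alone makes the rule applicable.
    have hl : l <+: w := by
      refine List.prefix_of_prefix_length_le (l₃ := w ++ (((l, r) :: D).map Prod.snd).flatten) ?_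
        (List.prefix_append _ _) (hlr.length_fst_le.trans hc.three_le_length)
      rw [e]
      exact List.prefix_append _ _
    obtain ⟨w, rfl⟩ := hl
    have e' : (w ++ r) ++ (D.map Prod.snd).flatten = (D.map Prod.fst).flatten := by
      simpa using e
    obtain h | h | ⟨c', hc', h⟩ := hc.of_rule hlr
    · exact Part.dom_iff_mem.2 ⟨c, StateTransition.mem_eval.2 ⟨.refl, h⟩⟩
    · exact ih hD' h e'
    · rw [StateTransition.reaches_eval (.single hc')]
      exact ih hD' h e'

/-! ### A halting machine lets the queue be emptied. -/

/-- Only tape letters have copying rules; a state can never be rotated on its own. -/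
theorem queue_rotate {M : TM0.Machine Γ Λ} {u : List (Letter Γ Λ)}
    (hu : ∀ x ∈ u, IsTapeLetter x) (v : List (Letter Γ Λ)) :
    ReflTransGen (QueueStep (Rule M)) (u ++ v) (v ++ u) := by
  induction u generalizing v with
  | nil => simpa using ReflTransGen.refl
  | cons x u ih =>
    refine .head (.mk (hu x List.mem_cons_self).rule (u ++ v)) ?_
    have := ih (fun y hy => hu y (List.mem_cons_of_mem _ hy)) (v ++ [x])
    simpa using this

/-- Bring `fin` to the front, let it swallow the next letter, and repeat. -/
theorem queue_erase {M : TM0.Machine Γ Λ} {u : List (Letter Γ Λ)}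
    (hu : ∀ x ∈ u, IsTapeLetter x) :
    ReflTransGen (QueueStep (Rule M)) (u ++ [fin]) [] := by
  induction u with
  | nil => exact .single (.mk Rule.done [])
  | cons x u ih =>
    refine (queue_rotate hu _).trans (.head ?_ (ih fun y hy => hu y (List.mem_cons_of_mem _ hy)))
    cases hu x List.mem_cons_self with
    | sym a => exact .mk (Rule.eraseSym a) u
    | sep => exact .mk Rule.eraseSep u

/-- The tape can be extended by a blank symbol where needed. -/
theorem Simulates.exists_head {M : TM0.Machine Γ Λ} {c : TM0.Cfg Γ Λ} {w : List (Letter Γ Λ)}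
    (h : Simulates c w) : ∃ L R a u v, c.Tape = Tape.mk₂ L (a :: R) ∧ v ≠ [] ∧
      u ++ v = tapeWord L (a :: R) ∧
      ReflTransGen (QueueStep (Rule M)) w (v ++ state c.q :: u) := by
  obtain ⟨L, R, u, v, hT, hv, e, rfl⟩ := h
  cases R with
  | cons a R => exact ⟨L, R, a, u, v, hT, hv, e, .refl⟩
  | nil =>
    refine ⟨L, [], default, [sym default, sep], sep :: (L.map sym).reverse,
      hT.trans (tape_mk₂_nil_right L), by simp, by simp [tapeWord], ?_⟩
    have hv' : ∀ x ∈ v, IsTapeLetter x := fun x hx =>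
      isTapeLetter_of_mem_tapeWord (L := L) (R := []) (e ▸ List.mem_append_right _ hx)
    refine (queue_rotate hv' _).tail ?_
    rw [List.cons_append, e]
    exact QueueStep.mk (Rule.extend c.q) (sep :: (L.map sym).reverse)

theorem Simulates.step {M : TM0.Machine Γ Λ} {c c' : TM0.Cfg Γ Λ} {w : List (Letter Γ Λ)}
    (h : Simulates c w) (hc : c' ∈ TM0.step M c) :
    ∃ w', Simulates c' w' ∧ ReflTransGen (QueueStep (Rule M)) w w' := by
  obtain ⟨L, R, a, u, v, hT, hv, e, hw⟩ := h.exists_head (M := M)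
  have hv' : ∀ x ∈ v, IsTapeLetter x := fun x hx =>
    isTapeLetter_of_mem_tapeWord (e ▸ List.mem_append_right _ hx)
  obtain ⟨q, T⟩ := c
  obtain rfl : T = _ := hT
  simp only [TM0.step, Option.mem_def, Option.map_eq_some_iff, tape_head_mk₂_cons] at hc
  obtain ⟨⟨q', s⟩, hM, rfl⟩ := hc
  have hrot : ReflTransGen (QueueStep (Rule M)) w ([state q, sym a] ++ tapeWord L R) := by
    refine hw.trans ?_
    have := queue_rotate (M := M) hv' (state q :: u)
    rw [List.cons_append, e] at this
    exact this
  match s with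
  | .write b =>
    exact ⟨_, ⟨L, b :: R, [sym b], tapeWord L R, rfl, by simp [tapeWord], rfl, rfl⟩,
      hrot.tail (.mk (.write hM) _)⟩
  | .move .right =>
    refine ⟨_, ⟨a :: L, R, [], tapeWord L R ++ [sym a], ?_, by simp, by simp [tapeWord], rfl⟩,
      hrot.tail ?_⟩
    · exact tape_move_right_mk₂_cons L R a
    · have := QueueStep.mk (Rule.right hM) (tapeWord L R)
      simpa using this
  | .move .left =>
    -- A left move needs the letter before the state, so the rotation stops one letter early. This
    -- is possible because `v` is nonempty.
    have hrot' : ∀ {x t}, IsTapeLetter x → tapeWord L R = t ++ [x] →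
        ReflTransGen (QueueStep (Rule M)) w ([x, state q, sym a] ++ t) := by
      intro x t hx ht
      obtain ⟨v, y, rfl⟩ := (List.eq_nil_or_concat v).resolve_left hv
      have e' : (u ++ v) ++ [y] = (sym a :: t) ++ [x] := by
        have e2 : tapeWord L (a :: R) = sym a :: tapeWord (Λ := Λ) L R := rfl
        rw [e2, ht] at e
        simpa using e
      obtain ⟨h1, h2⟩ := List.append_inj' e' rfl
      obtain rfl : y = x := by simpa using h2
      have := queue_rotate (M := M) (fun z hz => hv' z (by simp [hz]))
        (u := v) (y :: state q :: u)
      refine hw.trans ?_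
      rw [List.cons_append, List.cons_append, h1] at this
      simpa using this
    cases L with
    | cons b L =>
      refine ⟨_, ⟨L, b :: a :: R, [sym b, sym a], tapeWord L R, ?_, by simp [tapeWord], rfl, rfl⟩,
        (hrot' (.sym b) (t := tapeWord L R) (by simp [tapeWord])).tail (.mk (.left b hM) _)⟩
      exact tape_move_left_mk₂_cons _ _ _
    | nil =>
      refine ⟨_, ⟨[], default :: a :: R, [sym default, sym a], R.map sym ++ [sep, sep], ?_,
        by simp, rfl, rfl⟩, (hrot' .sep (t := R.map sym ++ [sep]) (by simp [tapeWord])).tail ?_⟩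
      · exact tape_move_left_mk₂_nil _
      · have := QueueStep.mk (Rule.leftSep hM) (R.map sym ++ [sep])
        simpa using this

theorem Simulates.reaches_nil_of_step_eq_none {M : TM0.Machine Γ Λ} {c : TM0.Cfg Γ Λ}
    {w : List (Letter Γ Λ)} (h : Simulates c w) (hc : TM0.step M c = none) :
    ReflTransGen (QueueStep (Rule M)) w [] := by
  obtain ⟨L, R, a, u, v, hT, hv, e, hw⟩ := h.exists_head (M := M)
  have hv' : ∀ x ∈ v, IsTapeLetter x := fun x hx =>
    isTapeLetter_of_mem_tapeWord (e ▸ List.mem_append_right _ hx)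
  obtain ⟨q, T⟩ := c
  obtain rfl : T = _ := hT
  simp only [TM0.step, Option.map_eq_none_iff, tape_head_mk₂_cons] at hc
  refine hw.trans ((queue_rotate hv' _).trans ?_)
  rw [List.cons_append, e]
  refine .head (QueueStep.mk (Rule.halt hc) (tapeWord L R)) ?_
  exact queue_erase fun x hx => isTapeLetter_of_mem_tapeWord hx

theorem Simulates.reaches_nil {M : TM0.Machine Γ Λ} {c : TM0.Cfg Γ Λ} {w : List (Letter Γ Λ)}
    (h : Simulates c w) (hc : (StateTransition.eval (TM0.step M) c).Dom) :
    ReflTransGen (QueueStep (Rule M)) w [] := by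
  obtain ⟨b, hb⟩ := Part.dom_iff_mem.1 hc
  obtain ⟨hr, hn⟩ := StateTransition.mem_eval.1 hb
  clear hc hb
  induction hr using ReflTransGen.head_induction_on generalizing w with
  | refl => exact h.reaches_nil_of_step_eq_none hn
  | head hcc' _ ih =>
    obtain ⟨w', hw', hr⟩ := h.step hcc'
    exact hr.trans (ih hw')

/-- The initial queue content for the given input. -/
def initWord (Λ : Type*) [Inhabited Λ] (T : List Γ) : List (Letter Γ Λ) :=
  T.map sym ++ [sep, sep, state default]

theorem simulates_init (T : List Γ) :
    Simulates (TM0.init T : TM0.Cfg Γ Λ) (initWord Λ T) :=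
  ⟨[], T, [], tapeWord [] T, rfl, by simp [tapeWord], rfl, by simp [tapeWord, initWord, TM0.init]⟩

/-- A Turing machine halts iff the queue of the queue system that simulates it can be emptied. -/
theorem eval_dom_iff (M : TM0.Machine Γ Λ) (T : List Γ) :
    (TM0.eval M T).Dom ↔ ∃ D : List (List (Letter Γ Λ) × List (Letter Γ Λ)),
      (∀ p ∈ D, Rule M p.1 p.2) ∧
        initWord Λ T ++ (D.map Prod.snd).flatten = (D.map Prod.fst).flatten :=
  ⟨fun h => exists_rules_of_queue_reaches_nil ((simulates_init T).reaches_nil h),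
    fun ⟨D, hD, e⟩ => Represents.eval_dom D hD (simulates_init T).represents e⟩

end TM0Queue

/-! ### A finite universal Turing machine with computable input. -/

open Turing StateTransition in
/-- A Turing machine that is supported on a finite set of states can be restricted to these. -/
theorem Turing.TM0.Supports.exists_finite {Γ Λ : Type} [Inhabited Γ] [Inhabited Λ]
    {M : TM0.Machine Γ Λ} {S : Set Λ} (hS : TM0.Supports M S) (hf : S.Finite) :
    ∃ (Λ' : Type) (_ : Inhabited Λ') (_ : Finite Λ') (M' : TM0.Machine Γ Λ'),
      ∀ T, (TM0.eval M' T).Dom ↔ (TM0.eval M T).Dom := by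
  classical
  let _ : Inhabited S := ⟨⟨default, hS.1⟩⟩
  -- A retraction onto `S`; its values outside `S` are irrelevant.
  let g : PointedMap Λ S := ⟨fun q => if h : q ∈ S then ⟨q, h⟩ else default, dif_pos hS.1⟩
  let i : PointedMap Γ Γ := ⟨id, rfl⟩
  refine ⟨S, inferInstance, hf, M.map i i g Subtype.val, fun T => ?_⟩
  have h := TM0.Machine.map_respects M i i g Subtype.val hS (fun _ => rfl)
    (fun q hq => congrArg Subtype.val (dif_pos hq))
  have hT : T.map i = T := List.map_id T
  have hi := TM0.map_init i g T
  rw [hT] at hi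
  exact StateTransition.tr_eval_dom h (a₁ := TM0.init T) (a₂ := TM0.init T) ⟨hS.1, hi⟩

namespace Turing.PartrecToTM2

/-- The successor on binary numerals, as lists of digits with the least significant one first. -/
def bitsSucc : List Γ' → List Γ'
  | [] => [Γ'.bit1]
  | Γ'.bit1 :: l => Γ'.bit0 :: bitsSucc l
  | _ :: l => Γ'.bit1 :: l

theorem trPosNum_succ (n : PosNum) : trPosNum n.succ = bitsSucc (trPosNum n) := by
  induction n with
  | one => rfl
  | bit0 n => rfl
  | bit1 n ih =>
    change Γ'.bit0 :: trPosNum n.succ = Γ'.bit0 :: bitsSucc (trPosNum n)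
    rw [ih]

/-- Presents `trNat` as an iteration of `bitsSucc`, hence as a primitive recursion. -/
theorem trNat_succ (n : ℕ) : trNat (n + 1) = bitsSucc (trNat n) := by
  rw [trNat, trNat, Nat.cast_succ, Num.add_one]
  cases (n : Num) with
  | zero => rfl
  | pos m => exact trPosNum_succ m

theorem primrec_bitsSucc [Primcodable Γ'] : Primrec bitsSucc := by
  have hh : Primrec₂ fun (_ : List Γ') (p : Γ' × List Γ' × List Γ') =>
      if p.1 = Γ'.bit1 then Γ'.bit0 :: p.2.2 else Γ'.bit1 :: p.2.1 := by
    have h1 : Primrec fun q : List Γ' × Γ' × List Γ' × List Γ' => q.2.1 :=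
      Primrec.fst.comp Primrec.snd
    have h2 : Primrec fun q : List Γ' × Γ' × List Γ' × List Γ' => q.2.2 :=
      Primrec.snd.comp Primrec.snd
    exact Primrec.ite ((PrimrecRel.comp Primrec.eq h1 (Primrec.const _)))
      (Primrec.list_cons.comp (Primrec.const _) (Primrec.snd.comp h2))
      (Primrec.list_cons.comp (Primrec.const _) (Primrec.fst.comp h2))
  refine (Primrec.list_rec Primrec.id (Primrec.const [Γ'.bit1]) hh).of_eq fun l => ?_
  induction l with
  | nil => rfl
  | cons a l ih => cases a <;> simp_all [bitsSucc]

theorem primrec_trNat [Primcodable Γ'] : Primrec trNat := by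
  refine (Primrec.nat_rec₁ [] (primrec_bitsSucc.comp Primrec.snd).to₂).of_eq fun n => ?_
  induction n with
  | zero => exact trNat_zero.symm
  | succ n ih => rw [trNat_succ, ← ih]

instance : Finite K' :=
  Finite.of_surjective (fun i : Fin 4 => match i with
    | 0 => K'.main | 1 => K'.rev | 2 => K'.aux | 3 => K'.stack) fun k => by
      cases k
      exacts [⟨0, rfl⟩, ⟨1, rfl⟩, ⟨2, rfl⟩, ⟨3, rfl⟩]

end Turing.PartrecToTM2

theorem Primcodable.nonempty_of_finite (α : Type*) [Finite α] : Nonempty (Primcodable α) :=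
  ⟨Primcodable.ofEquiv _ (Finite.equivFin α)⟩

/-- The shape of `TM2to1.trInit`. Letterwise maps between finite alphabets are primitive recursive
for free. -/
theorem Primrec.modify_head_map_reverse {α β : Type*} [Finite α] [Finite β] [Inhabited β]
    [Primcodable α] [Primcodable β] (f : α → β) (g : β → β) :
    Primrec fun L : List α => g (L.reverse.map f).headI :: (L.reverse.map f).tail :=
  have h : Primrec fun L : List α => L.reverse.map f :=
    Primrec.list_map Primrec.list_reverse ((Primrec.dom_finite f).comp Primrec.snd).to₂
  Primrec.list_cons.comp ((Primrec.dom_finite g).comp (Primrec.list_headI.comp h))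
    (Primrec.list_tail.comp h)

open Turing PartrecToTM2 in
theorem primrec_TM2to1_trInit {K : Type} [DecidableEq K] [Finite K] {Γ : K → Type}
    [∀ k, Finite (Γ k)] (k : K) [Primcodable (Γ k)] [Primcodable (TM2to1.Γ' K Γ)] :
    Primrec fun L : List (Γ k) => TM2to1.trInit k L :=
  have : Finite (TM2to1.Γ' K Γ) := inferInstanceAs (Finite (Bool × ∀ k, Option (Γ k)))
  Primrec.modify_head_map_reverse (β := TM2to1.Γ' K Γ)
    (fun a => (false, Function.update (fun _ => none) k (some a))) fun a => (true, a.2)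

open Turing PartrecToTM2 in
/-- There is a finite Turing machine that solves the halting problem positively: it halts on the
input for the number `k` iff the partial recursive function with code `k` is defined at `0`. -/
theorem exists_universal_TM0 :
    ∃ (Γ Λ : Type) (_ : Inhabited Γ) (_ : Inhabited Λ) (_ : Finite Γ) (_ : Finite Λ)
      (M : TM0.Machine Γ Λ) (input : ℕ → List Γ),
      (∀ [Primcodable Γ], Primrec input) ∧ ∀ k, (TM0.eval M (input k)).Dom ↔
        (Nat.Partrec.Code.eval (Denumerable.ofNat Nat.Partrec.Code k) 0).Dom := by
  classical
  have hf : Nat.Partrec fun k => Nat.Partrec.Code.eval (Denumerable.ofNat Nat.Partrec.Code k) 0 :=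
    Partrec.nat_iff.1 (Nat.Partrec.Code.eval_part.comp (Computable.ofNat _) (Computable.const 0))
  obtain ⟨c, hc⟩ := ToPartrec.Code.exists_code (Nat.Partrec'.part_iff₁.2 (Partrec.nat_iff.2 hf))
  -- The default label is where the machine starts, so it must be the entry point for `c`.
  let _ : Inhabited Λ' := ⟨trNormal c Cont'.halt⟩
  have h2 : TM2.Supports tr (codeSupp c Cont'.halt) := tr_supports c Cont'.halt
  have h1 := TM2to1.tr_supports tr h2
  have h0 := TM1to0.tr_supports (TM2to1.tr tr) h1
  obtain ⟨Λ, i1, i2, M, hM⟩ := h0.exists_finite (Finset.finite_toSet _)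
  have := Fintype.ofFinite K'
  refine ⟨TM2to1.Γ' K' fun _ => Γ', Λ, inferInstance, i1, ?_, i2, M,
    fun k => TM2to1.trInit K'.main (trList [k]), ?_, fun k => ?_⟩
  · exact inferInstanceAs (Finite (Bool × (K' → Option Γ')))
  · intro _
    obtain ⟨_⟩ := Primcodable.nonempty_of_finite Γ'
    -- `trList [k]` is `trNat k` followed by the terminator `Γ'.cons`.
    exact (primrec_TM2to1_trInit (Γ := fun _ => Γ') K'.main).comp
      (Primrec.list_append.comp primrec_trNat (Primrec.const [Γ'.cons]))
  · refine (hM _).trans ?_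
    rw [TM1to0.tr_eval]
    refine (TM2to1.tr_eval_dom tr K'.main (trList [k])).trans ?_
    have hi : (TM2.init K'.main (trList [k]) : Cfg') = init c [k] := by
      simp only [TM2.init, init]
      congr 1
      funext j
      cases j <;> rfl
    change (StateTransition.eval _ (TM2.init K'.main (trList [k]) : Cfg')).Dom ↔ _
    rw [hi, tr_eval]
    have := hc ⟨[k], rfl⟩
    simp only at this
    rw [this]
    rfl

/-! ### Coding queue letters over two letters. -/

/-- The code word of the number `k` in a prefix code over two letters. -/
def unaryCode {α : Type*} (z o : α) (k : ℕ) : List α :=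
  List.replicate k z ++ [o]

theorem unaryCode_append_inj {α : Type*} {z o : α} (h : z ≠ o) {j k : ℕ} {x y : List α}
    (e : unaryCode z o j ++ x = unaryCode z o k ++ y) : j = k ∧ x = y := by
  induction j generalizing k with
  | zero =>
    cases k with
    | zero => simpa [unaryCode] using e
    | succ k => exact absurd (List.cons.inj e).1 h.symm
  | succ j ih =>
    cases k with
    | zero => exact absurd (List.cons.inj e).1 h
    | succ k =>
      obtain ⟨rfl, h⟩ := ih (k := k) (List.cons.inj e).2
      exact ⟨rfl, h⟩

theorem flatMap_unaryCode_injective {α δ : Type*} {z o : α} (h : z ≠ o) {e : δ → ℕ}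
    (he : Function.Injective e) :
    Function.Injective fun x : List δ => x.flatMap fun a => unaryCode z o (e a) := by
  intro x
  induction x with
  | nil =>
    intro y hy
    cases y with
    | nil => rfl
    | cons b y => simp [unaryCode] at hy
  | cons a x ih =>
    intro y hy
    cases y with
    | nil => simp [unaryCode] at hy
    | cons b y =>
      simp only [List.flatMap_cons] at hy
      obtain ⟨h1, h2⟩ := unaryCode_append_inj h hy
      rw [he h1, ih h2]

/-! ### From queue rules to an automaton. -/

/-- For a finite set of pairs of words, regarded as rules of a queue system, the question whether a
queue can be emptied is the question whether an automaton, which is the concatenation of an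
automaton for the initial content and a fixed automaton, accepts a shuffle of a word and its marked
copy. -/
theorem exists_NFACode_of_rules {α δ : Type*} [Finite α] (code : List δ → List α)
    (hcode : Function.Injective code) (happend : ∀ x y, code (x ++ y) = code x ++ code y)
    {rule : List δ → List δ → Prop} (hfin : {p : List δ × List δ | rule p.1 p.2}.Finite) :
    ∃ A : NFACode (MarkedAlphabet α), ∀ w : List δ,
      (∃ v : List α, ∃ x ∈ (NFACode.prependWord (unmarked (code w)) A).language,
        x ∈ shuffle (unmarked v) (markedCopy v)) ↔
      ∃ D : List (List δ × List δ), (∀ p ∈ D, rule p.1 p.2) ∧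
        w ++ (D.map Prod.snd).flatten = (D.map Prod.fst).flatten := by
  let f : List δ × List δ → List (MarkedAlphabet α) := fun p =>
    unmarked (code p.2) ++ markedCopy (code p.1)
  have hnil : code [] = [] := by simpa using happend [] []
  have hX := Language.isRegular_kstar_of_finite (X := f '' {p | rule p.1 p.2}) (hfin.image f)
  -- `A` may be chosen nonconstructively, as it does not depend on `w`.
  obtain ⟨A, hA⟩ := (isRegular_iff_exists_NFACode _).1 hX
  refine ⟨A.sanitize, fun w => ?_⟩
  have hmem : ∀ x, x ∈ (NFACode.prependWord (unmarked (code w)) A.sanitize).language ↔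
      ∃ D : List (List δ × List δ), (∀ p ∈ D, rule p.1 p.2) ∧
        x = unmarked (code w) ++ (D.map f).flatten := by
    intro x
    rw [NFACode.mem_language_prependWord (NFACode.wellFormed_sanitize A),
      NFACode.language_sanitize, hA]
    constructor
    · rintro ⟨y, hy, rfl⟩
      obtain ⟨L, rfl, hL⟩ := Language.mem_kstar.1 hy
      choose! g hg using hL
      exact ⟨L.map g, by simpa using fun y hy => (hg y hy).1, by
        rw [List.map_map, List.map_congr_left (f := f ∘ g) (g := id) fun y hy => (hg y hy).2, List.map_id]⟩
    · rintro ⟨D, hD, rfl⟩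
      refine ⟨_, Language.mem_kstar.2 ⟨_, rfl, fun y hy => ?_⟩, rfl⟩
      obtain ⟨p, hp, rfl⟩ := List.mem_map.1 hy
      exact ⟨p, hD p hp, rfl⟩
  -- The unmarked letters record the initial content and all additions; `hm` below does the same for
  -- the removals.
  have hu : ∀ D : List (List δ × List δ), unmarkedPart (unmarked (code w) ++ (D.map f).flatten) =
      code (w ++ (D.map Prod.snd).flatten) := by
    intro D
    rw [happend, unmarkedPart, List.filterMap_append]
    congr 1
    · exact unmarkedPart_unmarked _
    · induction D with
      | nil => simp [hnil]
      | cons p D ih =>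
        simp only [List.map_cons, List.flatten_cons, List.filterMap_append, happend, ih, f]
        rw [show List.filterMap _ _ = _ from unmarkedPart_unmarked _,
          show List.filterMap _ _ = _ from unmarkedPart_markedCopy _, List.append_nil]
  have hm : ∀ D : List (List δ × List δ), markedPart (unmarked (code w) ++ (D.map f).flatten) =
      code (D.map Prod.fst).flatten := by
    intro D
    rw [markedPart, List.filterMap_append, show List.filterMap _ _ = _ from markedPart_unmarked _,
      List.nil_append]
    induction D with
    | nil => simp [hnil]
    | cons p D ih =>
      simp only [List.map_cons, List.flatten_cons, List.filterMap_append, happend, ih, f]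
      rw [show List.filterMap _ _ = _ from markedPart_unmarked _,
        show List.filterMap _ _ = _ from markedPart_markedCopy _, List.nil_append]
  simp only [mem_shuffle_unmarked_markedCopy_iff, hmem]
  constructor
  · rintro ⟨v, _, ⟨D, hD, rfl⟩, h1, h2⟩
    rw [hu] at h1
    rw [hm] at h2
    exact ⟨D, hD, hcode (h1.trans h2.symm)⟩
  · rintro ⟨D, hD, e⟩
    exact ⟨_, _, ⟨D, hD, rfl⟩, rfl, by rw [hu, hm, e]⟩

open TM0Queue in
instance {Γ Λ : Type*} [Finite Γ] [Finite Λ] : Finite (Letter Γ Λ) := by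
  refine Finite.of_surjective (fun x : (Λ ⊕ Γ) ⊕ Bool => match x with
    | .inl (.inl q) => Letter.state q
    | .inl (.inr a) => Letter.sym a
    | .inr false => Letter.sep
    | .inr true => Letter.fin) fun x => ?_
  cases x with
  | state q => exact ⟨.inl (.inl q), rfl⟩
  | sym a => exact ⟨.inl (.inr a), rfl⟩
  | sep => exact ⟨.inr false, rfl⟩
  | fin => exact ⟨.inr true, rfl⟩

open TM0Queue in
-- Both sides of a rule have bounded length over a finite alphabet.
theorem TM0Queue.finite_rules {Γ Λ : Type*} [Inhabited Γ] [Inhabited Λ] [Finite Γ] [Finite Λ]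
    (M : Turing.TM0.Machine Γ Λ) :
    {p : List (Letter Γ Λ) × List (Letter Γ Λ) | Rule M p.1 p.2}.Finite :=
  ((List.finite_length_le (Letter Γ Λ) 3).prod (List.finite_length_le (Letter Γ Λ) 4)).subset
    fun _ h => ⟨Rule.length_fst_le h, Rule.length_snd_le h⟩

/-! ### The reduction from the halting problem. -/

open TM0Queue in
theorem theorem3p10 (n : ℕ) (hn : 2 ≤ n) :
    ¬ ComputablePred (fun A : NFACode (MarkedAlphabet (Fin n)) =>
      ∃ w : List (Fin n), ∃ x ∈ NFACode.language A, x ∈ shuffle (unmarked w) (markedCopy w)) := by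
  obtain ⟨Γ, Λ, _, _, _, _, M, input, hinput, hM⟩ := exists_universal_TM0
  obtain ⟨_⟩ := Primcodable.nonempty_of_finite Γ
  obtain ⟨_⟩ := Primcodable.nonempty_of_finite (Letter Γ Λ)
  let e := Finite.equivFin (Letter Γ Λ)
  -- The two code letters 0 and 1 exist because `2 ≤ n`.
  let c : Letter Γ Λ → List (Fin n) := fun a => unaryCode ⟨0, by omega⟩ ⟨1, by omega⟩ (e a : ℕ)
  obtain ⟨A, hA⟩ := exists_NFACode_of_rules (fun x => x.flatMap c)
    (flatMap_unaryCode_injective (by simp) (Fin.val_injective.comp e.injective))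
    (fun x y => List.flatMap_append) (finite_rules M)
  have hred : Primrec fun k =>
      NFACode.prependWord (unmarked ((initWord Λ (input k)).flatMap c)) A := by
    refine (NFACode.primrec_prependWord A).comp (Primrec.list_map (Primrec.list_flatMap ?_
      ((Primrec.dom_finite c).comp Primrec.snd).to₂)
      ((Primrec.dom_finite Sum.inl).comp Primrec.snd).to₂)
    exact Primrec.list_append.comp
      (Primrec.list_map hinput ((Primrec.dom_finite _).comp Primrec.snd).to₂) (Primrec.const _)
  intro h
  refine ComputablePred.halting_problem 0 ?_
  -- The halting problem concerns codes, while `input` takes numbers, hence the composition with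
  -- `encode`.
  refine ComputablePred.computable_of_manyOneReducible
    ⟨_, hred.to_comp.comp Computable.encode, fun k => ?_⟩ h
  rw [hA, ← eval_dom_iff, hM, Denumerable.ofNat_encode]
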